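/- All graphs are finite and simple. For a graph $G=(V,E)$, a set of vertices is *stable* if no two of its vertices are adjacent; $\alpha(G)$ is the maximum size of a stable set, $\mu(G)$ is the maximum number of edges in a matching, and $\mathrm{core}(G)$ is the intersection of all maximum stable sets of $G$. The graph $G$ is *well-covered* if every inclusion-maximal stable set is a maximum stable set; *very well-covered* if it is well-covered, has no isolated vertices, and $|V|=2\alpha(G)$; *König–Egerváry* if $\alpha(G)+\mu(G)=|V|$; and *square-stable* if $\alpha(G)=\alpha(G^2)$, where $G^2$ is the graph on $V$ in which two distinct vertices are adjacent iff their distance in $G$ is $1$ or $2$. A vertex is *pendant* if it has exactly one neighbour, and an edge is *pendant* if at least one of its endpoints is pendant. The *girth* of $G$ is the length of a shortest cycle, and $\infty$ if $G$ has no cycle. **Theorem.** Let $G$ be a connected graph of girth at least $6$ that is isomorphic to neither $C_7$ nor $K_1$. Consider the following assertions: (i) $G$ is well-covered; (ii) $G$ has a perfect matching consisting of pendant edges; (iii) $G$ is very well-covered; (iv) $G$ is a König–Egerváry graph with exactly $\alpha(G)$ pendant vertices, and $\mathrm{core}(G)=\emptyset$; (v) $G$ is a König–Egerváry square-stable graph.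 Then (i), (ii), (iii) and (v) are equivalent. If moreover $G$ is not isomorphic to $K_2$, then all five assertions (i)–(v) are equivalent. -/

import Mathlib

namespace SimpleGraph

variable {V : Type*}

/-- A vertex is pendant if it has exactly one neighbour. -/
def IsPendant (G : SimpleGraph V) (v : V) : Prop := ∃! w, G.Adj v w

/-- An edge is pendant if at least one of its endpoints is a pendant vertex. -/
def IsPendantEdge (G : SimpleGraph V) (e : Sym2 V) : Prop :=
  e ∈ G.edgeSet ∧ ∃ v ∈ e, G.IsPendant v

/-- The graph has a perfect matching all of whose edges are pendant edges. -/
def HasPerfectMatchingOfPendantEdges (G : SimpleGraph V) : Prop :=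
  ∃ M : G.Subgraph, M.IsPerfectMatching ∧ ∀ e ∈ M.edgeSet, G.IsPendantEdge e

/-- The matching number: the maximum number of edges of a matching. -/
noncomputable def matchingNumber (G : SimpleGraph V) : ℕ :=
  sSup {k | ∃ M : G.Subgraph, M.IsMatching ∧ M.edgeSet.ncard = k}

/-- The stability number and the matching number add up to the order of the graph. -/
def IsKonigEgervary [Fintype V] (G : SimpleGraph V) : Prop :=
  G.indepNum + G.matchingNumber = Fintype.card V

/-- The intersection of all maximum stable sets. -/
def core [Fintype V] (G : SimpleGraph V) : Set V :=
  {v | ∀ S : Finset V, G.IsMaximumIndepSet S → v ∈ S}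

/-- Every inclusion-maximal stable set is a maximum stable set. -/
def IsWellCovered [Fintype V] (G : SimpleGraph V) : Prop :=
  ∀ S : Finset V, Maximal G.IsIndepSet (S : Set V) → G.IsMaximumIndepSet S

/-- Well-covered, without isolated vertices, and of order twice the stability number. -/
def IsVeryWellCovered [Fintype V] (G : SimpleGraph V) : Prop :=
  G.IsWellCovered ∧ (∀ v, ∃ w, G.Adj v w) ∧ Fintype.card V = 2 * G.indepNum

/-- The second power: vertices at distance 1 or 2 are joined. (The distance of vertices in
different components is 0 by convention, so such vertices are not joined.) -/
def secondPower (G : SimpleGraph V) : SimpleGraph V where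
  Adj u v := G.Adj u v ∨ G.dist u v = 2
  symm := ⟨fun u v h => by rwa [G.adj_comm v u, G.dist_comm (u := v)]⟩
  loopless := ⟨fun v h => by simp at h⟩

/-- A graph is square-stable if it has the same stability number as its second power. -/
def IsSquareStable (G : SimpleGraph V) : Prop :=
  G.indepNum = G.secondPower.indepNum

end SimpleGraph

/-!
The substance is that a connected well-covered graph `G` of girth at least six, other than `C₇` and
`K₁`, has a perfect matching of pendant edges. The remaining implications are counting arguments.

Well-coveredness is used through `DominationMonotone`: a stable set dominating everything that the
stable set `A` dominates has at least as many elements as `A`. To refute well-coveredness it is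
therefore enough to exhibit two small sets. The property passes to `G.detach v`, where the edges at
all neighbours of `v` are deleted, so one can use induction on the number of edges, for graphs which
need not be connected. The claim is local (`DominationMonotone.hasLocalStructure`): every vertex is
isolated, or lies on a pendant edge, or lies on a component isomorphic to `C₇`.

For the induction step, a `C₇`-component of `G.detach v` is already a component of `G`, since an
edge from it to a neighbour of `v` would give two sets violating monotonicity
(`IsSevenCycle.not_adj`). If `l` is pendant with neighbour `m`, the structure of `G.detach l` shows
that all neighbours of `m` lie on pendant edges (`onPendantEdge_of_adj_adj_isPendant`), so lying on
a pendant edge is constant on components. In a component without pendant edges, the structure of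
`G.detach v` shows that every vertex at distance two from `v` has exactly two neighbours
(`isPendant_detach_of_not_onPendantEdge`). The component is then a cycle, and comparing two
explicit stable sets leaves only `C₇` (`exists_isSevenCycle_of_two_regular_walk`).

Conversely, given a perfect matching of pendant edges, every maximal stable set contains exactly one
vertex of each edge, which yields very well-coveredness, the König–Egerváry property and the values
of the other invariants. Going back from a König–Egerváry graph, a maximum matching joins the
complement of any maximum stable set `S` injectively to `S` (`IsKonigEgervary.exists_isMatching`).
For square-stable graphs, `S` is taken to be stable in the square; otherwise `S` is the set of
pendant vertices. In both cases the matching is perfect and consists of pendant edges.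
-/

namespace SimpleGraph

variable {V : Type*}

/-! ### Short cycles -/

/-- Girth at least six in terms of adjacencies. Triangles need no clause of their own: going round
a triangle and then back and forth along an edge is a closed walk of length five. -/
structure NoShortCycle (G : SimpleGraph V) : Prop where
  four : ∀ a b c d, G.Adj a b → G.Adj b c → G.Adj c d → G.Adj d a → a = c ∨ b = d
  five : ∀ a b c d e, G.Adj a b → G.Adj b c → G.Adj c d → G.Adj d e → G.Adj e a → False

lemma NoShortCycle.three {G : SimpleGraph V} (h : G.NoShortCycle) (a b c : V)
    (hab : G.Adj a b) (hbc : G.Adj b c) (hca : G.Adj c a) : False :=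
  h.five a b c a b hab hbc hca hab hab.symm

lemma NoShortCycle.mono {G H : SimpleGraph V} (h : G.NoShortCycle) (hle : H ≤ G) :
    H.NoShortCycle where
  four _ _ _ _ h1 h2 h3 h4 := h.four _ _ _ _ (hle h1) (hle h2) (hle h3) (hle h4)
  five _ _ _ _ _ h1 h2 h3 h4 h5 :=
    h.five _ _ _ _ _ (hle h1) (hle h2) (hle h3) (hle h4) (hle h5)

lemma noShortCycle_of_six_le_egirth {G : SimpleGraph V} (hg : 6 ≤ G.egirth) :
    G.NoShortCycle := by
  rw [le_egirth] at hg
  have h3 : ∀ a b c, G.Adj a b → G.Adj b c → G.Adj c a → False := by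
    intro a b c hab hbc hca
    have := hg a (.cons hab (.cons hbc (.cons hca .nil))) (by
      have := hab.ne; have := hbc.ne; have := hca.ne
      simp [Walk.isCycle_def, Walk.isTrail_def]
      grind)
    norm_num at this
  have h4 : ∀ a b c d, G.Adj a b → G.Adj b c → G.Adj c d → G.Adj d a → a = c ∨ b = d := by
    intro a b c d hab hbc hcd hda
    by_contra! hne
    have := hg a (.cons hab (.cons hbc (.cons hcd (.cons hda .nil)))) (by
      have := hab.ne; have := hbc.ne; have := hcd.ne; have := hda.ne
      simp [Walk.isCycle_def, Walk.isTrail_def]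
      grind)
    norm_num at this
  refine ⟨h4, fun a b c d e hab hbc hcd hde hea => ?_⟩
  -- If two non-consecutive vertices coincide, three of the five edges form a triangle.
  rcases eq_or_ne a c with rfl | hac
  · exact h3 _ _ _ hcd hde hea
  rcases eq_or_ne a d with rfl | had
  · exact h3 _ _ _ hab hbc hcd
  rcases eq_or_ne b d with rfl | hbd
  · exact h3 _ _ _ hab hde hea
  rcases eq_or_ne b e with rfl | hbe
  · exact h3 _ _ _ hbc hcd hde
  rcases eq_or_ne c e with rfl | hce
  · exact h3 _ _ _ hab hbc hea
  have := hg a (.cons hab (.cons hbc (.cons hcd (.cons hde (.cons hea .nil))))) (by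
    have := hab.ne; have := hbc.ne; have := hcd.ne; have := hde.ne; have := hea.ne
    simp [Walk.isCycle_def, Walk.isTrail_def]
    grind)
  norm_num at this

/-! ### Domination by stable sets -/

/-- The vertex `x` lies in the closed neighbourhood of `A`. -/
def Dominates (G : SimpleGraph V) (A : Finset V) (x : V) : Prop := ∃ a ∈ A, a = x ∨ G.Adj a x

/-- A stable set whose closed neighbourhood contains that of the stable set `A` has at least as
many elements as `A`. For finite graphs this is a reformulation of well-coveredness; the form
given here passes to graphs obtained by deleting a closed neighbourhood and refutes
well-coveredness by exhibiting two small sets. -/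
def DominationMonotone (G : SimpleGraph V) : Prop :=
  ∀ A B : Finset V, G.IsIndepSet (A : Set V) → G.IsIndepSet (B : Set V) →
    (∀ x, G.Dominates A x → G.Dominates B x) → A.card ≤ B.card

lemma isIndepSet_coe_iff {G : SimpleGraph V} {A : Finset V} :
    G.IsIndepSet (A : Set V) ↔ ∀ a ∈ A, ∀ b ∈ A, ¬ G.Adj a b := by
  refine ⟨fun h a ha b hb hab => h ha hb hab.ne hab, fun h a ha b hb _ => h a ha b hb⟩

lemma exists_maximal_isIndepSet [Finite V] {G : SimpleGraph V} {B : Finset V}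
    (hB : G.IsIndepSet (B : Set V)) :
    ∃ T : Finset V, B ⊆ T ∧ Maximal G.IsIndepSet (T : Set V) := by
  obtain ⟨T, hBT, hT⟩ := (Set.toFinite {S : Set V | G.IsIndepSet S}).exists_le_maximal hB
  lift T to Finset V using Set.toFinite T
  exact ⟨T, by simpa using hBT, hT⟩

/-- A maximal stable set dominates every vertex. -/
lemma exists_adj_of_maximal_isIndepSet {G : SimpleGraph V} {T : Finset V}
    (hT : Maximal G.IsIndepSet (T : Set V)) {v : V} (hv : v ∉ T) : ∃ w ∈ T, G.Adj v w := by
  by_contra! h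
  have hins : G.IsIndepSet (insert v (T : Set V)) :=
    hT.prop.insert fun b hb _ => ⟨h b hb, fun hbv => h b hb hbv.symm⟩
  exact hv (by simpa using hT.le_of_ge hins (Set.subset_insert _ _) (Set.mem_insert _ _))

lemma IsWellCovered.dominationMonotone [Fintype V] {G : SimpleGraph V} (hG : G.IsWellCovered) :
    G.DominationMonotone := by
  classical
  intro A B hA hB hdom
  obtain ⟨T, hBT, hT⟩ := exists_maximal_isIndepSet hB
  -- Exchange `B` for `A` inside a maximal stable set containing `B`.
  have hTind := isIndepSet_coe_iff.1 hT.prop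
  have hfree : ∀ a ∈ A, ∀ t ∈ T \ B, a ≠ t ∧ ¬ G.Adj a t := by
    intro a ha t ht
    rw [Finset.mem_sdiff] at ht
    by_contra hcon
    obtain ⟨b, hb, rfl | hbt⟩ := hdom t ⟨a, ha, by tauto⟩
    · exact ht.2 hb
    · exact hTind b (hBT hb) t ht.1 hbt
  have hind : G.IsIndepSet ((A ∪ T \ B : Finset V) : Set V) := by
    rw [isIndepSet_coe_iff] at hA ⊢
    intro x hx y hy hxy
    rcases Finset.mem_union.1 hx with hx | hx <;> rcases Finset.mem_union.1 hy with hy | hy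
    · exact hA x hx y hy hxy
    · exact (hfree x hx y hy).2 hxy
    · exact (hfree y hy x hx).2 hxy.symm
    · exact hTind x (Finset.mem_sdiff.1 hx).1 y (Finset.mem_sdiff.1 hy).1 hxy
  have hdisj : Disjoint A (T \ B) :=
    Finset.disjoint_left.2 fun a ha ht => (hfree a ha a ht).1 rfl
  have h1 := (hG T hT).maximum _ hind
  rw [Finset.card_union_of_disjoint hdisj] at h1
  have h2 := Finset.card_sdiff_add_card_eq_card hBT
  omega

/-- Two pendant vertices cannot share their neighbour. -/
lemma DominationMonotone.eq_of_isPendant {G : SimpleGraph V} (hG : G.DominationMonotone)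
    {v l l' : V} (hl : G.IsPendant l) (hl' : G.IsPendant l') (h : G.Adj v l) (h' : G.Adj v l') :
    l = l' := by
  classical
  by_contra hne
  have hu := fun w hw => hl.unique (y₁ := w) hw h.symm
  have hu' := fun w hw => hl'.unique (y₁ := w) hw h'.symm
  have := hG {l, l'} {v} (by
      rw [isIndepSet_coe_iff]
      have := h.ne; have := h'.ne
      simp only [Finset.mem_insert, Finset.mem_singleton]
      rintro a (rfl | rfl) b (rfl | rfl) hab <;> grind) (by simp) (by
      rintro x ⟨a, ha, hax⟩
      refine ⟨v, by simp, ?_⟩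
      simp only [Finset.mem_insert, Finset.mem_singleton] at ha
      rcases ha with rfl | rfl <;> grind)
  rw [Finset.card_pair hne] at this
  simp at this

/-! ### Detaching a closed neighbourhood -/

/-- The graph with all edges at neighbours of `v` deleted. Up to isolated vertices, this is `G`
with the closed neighbourhood of `v` removed. -/
def detach (G : SimpleGraph V) (v : V) : SimpleGraph V where
  Adj a b := G.Adj a b ∧ ¬ G.Adj v a ∧ ¬ G.Adj v b
  symm := ⟨fun _ _ h => ⟨h.1.symm, h.2.2, h.2.1⟩⟩
  loopless := ⟨fun _ h => h.1.ne rfl⟩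

lemma detach_le (G : SimpleGraph V) (v : V) : G.detach v ≤ G := fun _ _ h => h.1

lemma DominationMonotone.detach {G : SimpleGraph V} (hG : G.DominationMonotone) (v : V) :
    (G.detach v).DominationMonotone := by
  classical
  intro A B hA hB hdom
  rw [isIndepSet_coe_iff] at hA hB
  -- Outside the closed neighbourhood of `v` the sets `A` and `B` are compared in `G`, after adding
  -- `v` to both; inside, every vertex is isolated in `G.detach v`, and `A` is contained in `B`.
  let N : V → Prop := fun x => x = v ∨ G.Adj v x
  have hind : ∀ S : Finset V, (∀ a ∈ S, ∀ b ∈ S, ¬ (G.detach v).Adj a b) →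
      G.IsIndepSet ((insert v (S.filter fun x => ¬ N x) : Finset V) : Set V) := by
    intro S hS
    rw [isIndepSet_coe_iff]
    simp only [Finset.mem_insert, Finset.mem_filter, N]
    rintro a (rfl | ⟨ha, ha'⟩) b (rfl | ⟨hb, hb'⟩) hab
    · exact hab.ne rfl
    · tauto
    · exact ha' (.inr hab.symm)
    · exact hS a ha b hb ⟨hab, by tauto, by tauto⟩
  have hout := hG _ _ (hind A hA) (hind B hB) (by
    rintro x ⟨a, ha, hax⟩
    by_cases hx : N x
    · exact ⟨v, by simp, by rcases hx with rfl | hx <;> tauto⟩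
    rcases Finset.mem_insert.1 ha with rfl | ha
    · exact ⟨a, by simp, hax⟩
    obtain ⟨ha, haN⟩ := Finset.mem_filter.1 ha
    obtain ⟨b, hb, hbx⟩ := hdom x ⟨a, ha, by
      rcases hax with h | h
      · exact .inl h
      · exact .inr ⟨h, fun h => haN (.inr h), fun h => hx (.inr h)⟩⟩
    refine ⟨b, Finset.mem_insert_of_mem (Finset.mem_filter.2 ⟨hb, ?_⟩),
      hbx.imp_right fun h => h.1⟩
    rcases hbx with rfl | hbx
    · exact hx
    · rintro (rfl | h)
      · exact hx (.inr hbx.1)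
      · exact hbx.2.1 h)
  have hin : (A.filter N) ⊆ (B.filter N) := by
    intro x hx
    obtain ⟨hxA, hxN⟩ := Finset.mem_filter.1 hx
    obtain ⟨b, hb, rfl | hbx⟩ := hdom x ⟨x, hxA, .inl rfl⟩
    · exact Finset.mem_filter.2 ⟨hb, hxN⟩
    · rcases hxN with rfl | h
      · exact (hbx.2.1 hbx.1.symm).elim
      · exact (hbx.2.2 h).elim
  have hv : ∀ S : Finset V, v ∉ S.filter fun x => ¬ N x := by simp [N]
  rw [Finset.card_insert_of_notMem (hv A), Finset.card_insert_of_notMem (hv B)] at hout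
  have := Finset.card_le_card hin
  have hcA := Finset.card_filter_add_card_filter_not (s := A) N
  have hcB := Finset.card_filter_add_card_filter_not (s := B) N
  omega

lemma detach_ncard_edgeSet_lt [Finite V] {G : SimpleGraph V} {v w : V} (h : G.Adj v w) :
    (G.detach v).edgeSet.ncard < G.edgeSet.ncard := by
  refine Set.ncard_lt_ncard ?_ (Set.toFinite _)
  rw [edgeSet_ssubset_edgeSet]
  refine lt_of_le_of_ne (detach_le G v) fun heq => ?_
  rw [← heq] at h
  exact h.2.2 h.1

/-! ### Seven-cycles -/

/-- The injective map `c` runs through a seven-cycle whose vertices have no neighbours off the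
cycle, that is, through a component isomorphic to `C₇`. -/
structure IsSevenCycle (G : SimpleGraph V) (c : Fin 7 → V) : Prop where
  injective : Function.Injective c
  adj : ∀ i, G.Adj (c i) (c (i + 1))
  eq_or_eq : ∀ i w, G.Adj (c i) w → w = c (i + 1) ∨ w = c (i - 1)

lemma IsSevenCycle.rotate {G : SimpleGraph V} {c : Fin 7 → V} (hc : G.IsSevenCycle c)
    (k : Fin 7) : G.IsSevenCycle fun i => c (i + k) where
  injective := hc.injective.comp (add_left_injective k)
  adj i := by simpa [add_right_comm] using hc.adj (i + k)
  eq_or_eq i w h := by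
    have := hc.eq_or_eq (i + k) w h
    rwa [add_right_comm, add_sub_right_comm] at this

lemma IsSevenCycle.reflect {G : SimpleGraph V} {c : Fin 7 → V} (hc : G.IsSevenCycle c) :
    G.IsSevenCycle fun i => c (-i) where
  injective := hc.injective.comp neg_injective
  adj i := by
    have := (hc.adj (-(i + 1))).symm
    rwa [neg_add, neg_add_cancel_right, ← neg_add] at this
  eq_or_eq i w h := by
    rcases hc.eq_or_eq (-i) w h with h | h
    · right; rwa [neg_sub, ← neg_add_eq_sub]
    · left; rwa [neg_add, ← sub_eq_add_neg]

/-- If `p` attaches `c 0` to `v`, and neither `c 1` nor `c 3` is attached to `v`, then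
`{p, c 1, c 3, c 5}` is dominated by the smaller set `{p, c 2, c 5}`. -/
lemma IsSevenCycle.not_adj_zero {G : SimpleGraph V} (hS : G.NoShortCycle)
    (hG : G.DominationMonotone) {v p : V} {c : Fin 7 → V} (hc : (G.detach v).IsSevenCycle c)
    (h1 : ∀ q, G.Adj v q → ¬ G.Adj q (c 1)) (h3 : ∀ q, G.Adj v q → ¬ G.Adj q (c 3))
    (hvp : G.Adj v p) : ¬ G.Adj p (c 0) := by
  classical
  intro hp0
  have hcv : ∀ i, ¬ G.Adj v (c i) := fun i => (hc.adj i).2.1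
  have hadj : ∀ i, G.Adj (c i) (c (i + 1)) := fun i => (hc.adj i).1
  have hpc : ∀ i, p ≠ c i := fun i h => hcv i (h ▸ hvp)
  have hne : ∀ i j : Fin 7, i ≠ j → c i ≠ c j := fun i j h => hc.injective.ne h
  have hnbr : ∀ i w, G.Adj (c i) w → G.Adj v w ∨ w = c (i + 1) ∨ w = c (i - 1) := by
    intro i w h
    by_cases hw : G.Adj v w
    · exact .inl hw
    · exact .inr (hc.eq_or_eq i w ⟨h, hcv i, hw⟩)
  have hnadj : ∀ i j : Fin 7, j ≠ i + 1 → j ≠ i - 1 → ¬ G.Adj (c i) (c j) := by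
    intro i j hj hj' h
    rcases hnbr i _ h with h | h | h
    · exact hcv j h
    · exact hj (hc.injective h)
    · exact hj' (hc.injective h)
  have hp1 := h1 p hvp
  have hp3 := h3 p hvp
  have hp2 : ¬ G.Adj p (c 2) := fun h => by
    rcases hS.four p (c 0) (c 1) (c 2) hp0 (hadj 0) (hadj 1) h.symm with h | h
    · exact hpc _ h
    · exact hne 0 2 (by decide) h
  have hp5 : ¬ G.Adj p (c 5) := fun h => by
    rcases hS.four p (c 5) (c 6) (c 0) h (hadj 5) (hadj 6) hp0.symm with h | h
    · exact hpc _ h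
    · exact hne 5 0 (by decide) h
  have n13 := hnadj 1 3 (by decide) (by decide)
  have n15 := hnadj 1 5 (by decide) (by decide)
  have n35 := hnadj 3 5 (by decide) (by decide)
  have n25 := hnadj 2 5 (by decide) (by decide)
  have hcard := hG {p, c 1, c 3, c 5} {p, c 2, c 5} (by
      rw [isIndepSet_coe_iff]
      simp only [Finset.mem_insert, Finset.mem_singleton]
      rintro a (rfl | rfl | rfl | rfl) b (rfl | rfl | rfl | rfl) hab <;>
        first
        | exact hab.ne rfl
        | (have := hab.symm; contradiction)) (by
      rw [isIndepSet_coe_iff]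
      simp only [Finset.mem_insert, Finset.mem_singleton]
      rintro a (rfl | rfl | rfl) b (rfl | rfl | rfl) hab <;>
        first
        | exact hab.ne rfl
        | (have := hab.symm; contradiction)) (by
      rintro x ⟨a, ha, hax⟩
      have hp : p ∈ ({p, c 2, c 5} : Finset V) := by simp
      have h2 : c 2 ∈ ({p, c 2, c 5} : Finset V) := by simp
      have h5 : c 5 ∈ ({p, c 2, c 5} : Finset V) := by simp
      simp only [Finset.mem_insert, Finset.mem_singleton] at ha
      rcases ha with rfl | rfl | rfl | rfl
      · exact ⟨_, hp, hax⟩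
      · rcases hax with rfl | hax
        · exact ⟨_, h2, .inr (hadj 1).symm⟩
        · rcases hnbr 1 x hax with h | rfl | rfl
          · exact (h1 x h hax.symm).elim
          · exact ⟨_, h2, .inl rfl⟩
          · exact ⟨_, hp, .inr hp0⟩
      · rcases hax with rfl | hax
        · exact ⟨_, h2, .inr (hadj 2)⟩
        · rcases hnbr 3 x hax with h | rfl | rfl
          · exact (h3 x h hax.symm).elim
          · exact ⟨_, h5, .inr (hadj 4).symm⟩
          · exact ⟨_, h2, .inl rfl⟩
      · exact ⟨_, h5, hax⟩)
  rw [Finset.card_insert_of_notMem (by simp [hpc]),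
    Finset.card_insert_of_notMem (by simp [hne 1 3 (by decide), hne 1 5 (by decide)]),
    Finset.card_pair (hne 3 5 (by decide)), Finset.card_insert_of_notMem (by simp [hpc]),
    Finset.card_pair (hne 2 5 (by decide))] at hcard
  omega

/-- No vertex of a `C₇`-component of `G.detach v` is adjacent to a neighbour of `v`. -/
lemma IsSevenCycle.not_adj {G : SimpleGraph V} (hS : G.NoShortCycle)
    (hG : G.DominationMonotone) {v p : V} {c : Fin 7 → V} (hc : (G.detach v).IsSevenCycle c)
    (hvp : G.Adj v p) (k : Fin 7) : ¬ G.Adj p (c k) := by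
  intro hpk
  -- Consecutive vertices cannot both be attached to `v`. Hence of the two vertices at distance
  -- three from `c k` one is not attached, and a rotation or a reflection makes it `c 3`.
  have hcons : ∀ i q r, G.Adj v q → G.Adj v r → G.Adj q (c i) → ¬ G.Adj r (c (i + 1)) :=
    fun i q r hq hr hqi hri =>
      hS.five v q (c i) (c (i + 1)) r hq hqi (hc.adj i).1 hri.symm hr.symm
  by_cases h3 : ∀ q, G.Adj v q → ¬ G.Adj q (c (k + 3))
  · refine IsSevenCycle.not_adj_zero hS hG (hc.rotate k) (fun q hq => ?_) ?_ hvp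
      (by simpa using hpk)
    · simpa [add_comm] using hcons k p q hvp hq hpk
    · simpa [add_comm] using h3
  · push Not at h3
    obtain ⟨r, hvr, hr⟩ := h3
    have hc' := (hc.rotate k).reflect
    refine IsSevenCycle.not_adj_zero hS hG hc' (fun q hq h => ?_) (fun q hq h => ?_) hvp
      (by simpa using hpk)
    · refine hcons (-1 + k) q p hq hvp h ?_
      rwa [neg_add_cancel_comm]
    · refine hcons (k + 3) r q hvr hq hr ?_
      have : ∀ k : Fin 7, k + 3 + 1 = -3 + k := by decide
      rwa [this]

lemma IsSevenCycle.of_detach {G : SimpleGraph V} (hS : G.NoShortCycle)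
    (hG : G.DominationMonotone) {v : V} {c : Fin 7 → V} (hc : (G.detach v).IsSevenCycle c) :
    G.IsSevenCycle c where
  injective := hc.injective
  adj i := (hc.adj i).1
  eq_or_eq i w h :=
    hc.eq_or_eq i w ⟨h, (hc.adj i).2.1, fun hw => hc.not_adj hS hG hw i h.symm⟩

/-! ### Local structure of well-covered graphs -/

/-- The vertex `x` lies on a pendant edge. -/
def OnPendantEdge (G : SimpleGraph V) (x : V) : Prop :=
  G.IsPendant x ∨ ∃ l, G.Adj x l ∧ G.IsPendant l

/-- The local structure to be established at each vertex: it is isolated, or lies on a pendant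
edge, or on a component isomorphic to `C₇`. -/
def HasLocalStructure (G : SimpleGraph V) (x : V) : Prop :=
  (∀ w, ¬ G.Adj x w) ∨ G.OnPendantEdge x ∨ ∃ c, G.IsSevenCycle c ∧ x ∈ Set.range c

/-- A pendant vertex of `G.detach v` is pendant in `G` unless adjacent to a neighbour of `v`. -/
lemma IsPendant.of_detach {G : SimpleGraph V} {v z : V} (hz : (G.detach v).IsPendant z)
    (h : ∀ p, G.Adj v p → ¬ G.Adj p z) : G.IsPendant z := by
  obtain ⟨w, hw, hu⟩ := hz
  exact ⟨w, hw.1, fun y hy => hu y ⟨hy, hw.2.1, fun hvy => h y hvy hy.symm⟩⟩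

/-- Neighbours of the neighbour `m` of a pendant vertex `l` lie on pendant edges, provided
`G.detach l` has the local structure. -/
lemma onPendantEdge_of_adj_adj_isPendant {G : SimpleGraph V} (hS : G.NoShortCycle)
    (hG : G.DominationMonotone) {l m y : V} (hl : G.IsPendant l) (hlm : G.Adj l m)
    (hmy : G.Adj m y) (hstr : (G.detach l).HasLocalStructure y) : G.OnPendantEdge y := by
  classical
  have hlu : ∀ q, G.Adj l q → q = m := fun q hq => hl.unique hq hlm
  rcases eq_or_ne y l with rfl | hyl
  · exact .inl hl
  have hly : ¬ G.Adj l y := fun h => hmy.ne (hlu y h).symm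
  rcases hstr with hiso | hpe | ⟨c, hc, i, rfl⟩
  · -- `y` is adjacent to `m` only.
    refine .inl ⟨m, hmy.symm, fun q hq => ?_⟩
    by_contra hqm
    exact hiso q ⟨hq, hly, fun h => hqm (hlu q h)⟩
  · rcases hpe with hy | ⟨z, hyz, hz⟩
    · obtain ⟨w, hyw, hyu⟩ := hy
      have hmw : ¬ G.Adj m w := fun h => hS.three m y w hmy hyw.1 h.symm
      by_cases hw : (G.detach l).IsPendant w
      · refine .inr ⟨w, hyw.1, hw.of_detach fun p hp => ?_⟩
        rwa [hlu p hp]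
      -- A further neighbour `u` of `w` makes `{m, u}` dominate the larger set `{l, y, u}`.
      exfalso
      obtain ⟨u, hwu, huy⟩ : ∃ u, (G.detach l).Adj w u ∧ u ≠ y := by
        by_contra! hcon
        exact hw ⟨y, hyw.symm, hcon⟩
      have hum : u ≠ m := fun h => hwu.2.2 (h ▸ hlm)
      have hul : u ≠ l := by
        rintro rfl
        exact hwu.2.1 hwu.1.symm
      have hlu' : ¬ G.Adj l u := hwu.2.2
      have hmu : ¬ G.Adj m u := fun h => by
        rcases hS.four m y w u hmy hyw.1 hwu.1 h.symm with h | h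
        · exact hwu.2.1 (h ▸ hlm)
        · exact huy h.symm
      have hyu' : ¬ G.Adj y u := fun h => hS.three y w u hyw.1 hwu.1 h.symm
      have hcard := hG {l, y, u} {m, u} (by
          rw [isIndepSet_coe_iff]
          simp only [Finset.mem_insert, Finset.mem_singleton]
          rintro a (rfl | rfl | rfl) b (rfl | rfl | rfl) hab <;>
            first
            | exact hab.ne rfl
            | (have := hab.symm; contradiction)) (by
          rw [isIndepSet_coe_iff]
          simp only [Finset.mem_insert, Finset.mem_singleton]
          rintro a (rfl | rfl) b (rfl | rfl) hab <;>
            first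
            | exact hab.ne rfl
            | (have := hab.symm; contradiction)) (by
          rintro x ⟨a, ha, hax⟩
          simp only [Finset.mem_insert, Finset.mem_singleton] at ha
          rcases ha with rfl | rfl | rfl
          · rcases hax with rfl | hax
            · exact ⟨m, by simp, .inr hlm.symm⟩
            · exact ⟨m, by simp, .inl (hlu x hax).symm⟩
          · rcases hax with rfl | hax
            · exact ⟨m, by simp, .inr hmy⟩
            · by_cases hlx : G.Adj l x
              · exact ⟨m, by simp, .inl (hlu x hlx).symm⟩
              · obtain rfl := hyu x ⟨hax, hly, hlx⟩
                exact ⟨u, by simp, .inr hwu.1.symm⟩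
          · exact ⟨a, by simp, hax⟩)
      rw [Finset.card_insert_of_notMem (by simp [hyl.symm, hul.symm]),
        Finset.card_pair huy.symm, Finset.card_pair hum.symm] at hcard
      omega
    · refine .inr ⟨z, hyz.1, hz.of_detach fun p hp hpz => ?_⟩
      rw [hlu p hp] at hpz
      exact hS.three m y z hmy hyz.1 hpz.symm
  · exact (hc.not_adj hS hG hlm i hmy).elim

/-- Let `v, p, z` be a path, where neither `z` nor any neighbour of `z` is pendant. Then `z` has
exactly two neighbours: it is pendant in `G.detach v`, and only its neighbour `p` is lost there. -/
lemma isPendant_detach_of_not_onPendantEdge {G : SimpleGraph V} (hS : G.NoShortCycle)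
    (hG : G.DominationMonotone) {v p z : V} (hvp : G.Adj v p) (hpz : G.Adj p z) (hzv : z ≠ v)
    (hz : ∀ w, (w = z ∨ G.Adj z w) → ¬ G.IsPendant w)
    (hstr : (G.detach v).HasLocalStructure z) : (G.detach v).IsPendant z := by
  have hvz : ¬ G.Adj v z := fun h => hS.three v p z hvp hpz h.symm
  have huniq : ∀ q, G.Adj v q → G.Adj z q → q = p := fun q hq hzq => by
    rcases hS.four v p z q hvp hpz hzq hq.symm with h | h
    · exact (hzv h.symm).elim
    · exact h.symm
  rcases hstr with hiso | (hzp | ⟨z', hzz', hz'⟩) | ⟨c, hc, i, rfl⟩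
  · refine (hz z (.inl rfl) ⟨p, hpz.symm, fun q hq => ?_⟩).elim
    by_contra hqp
    exact hiso q ⟨hq, hvz, fun h => hqp (huniq q h hq)⟩
  · exact hzp
  · refine (hz z' (.inr hzz'.1) (hz'.of_detach fun q hq hqz' => ?_)).elim
    exact hS.five v p z z' q hvp hpz hzz'.1 hqz'.symm hq.symm
  · exact (hc.not_adj hS hG hvp i hpz).elim

/-- Let `b, q, x, p, a, c, e, f` be consecutive vertices of a walk in a graph without short cycles,
where each of the inner ones has only its two neighbours on the walk. Domination monotonicity
forces the walk to close up as a seven-cycle, with `f = b`. -/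
lemma exists_isSevenCycle_of_two_regular_walk {G : SimpleGraph V} (hS : G.NoShortCycle)
    (hG : G.DominationMonotone) {b q x p a c e f : V}
    (hbq : G.Adj b q) (hqx : G.Adj q x) (hxp : G.Adj x p) (hpa : G.Adj p a) (hac : G.Adj a c)
    (hce : G.Adj c e) (hef : G.Adj e f)
    (hq : ∀ w, G.Adj q w → w = x ∨ w = b) (hx : ∀ w, G.Adj x w → w = p ∨ w = q)
    (hp : ∀ w, G.Adj p w → w = x ∨ w = a) (ha : ∀ w, G.Adj a w → w = p ∨ w = c)
    (hc : ∀ w, G.Adj c w → w = a ∨ w = e) (he : ∀ w, G.Adj e w → w = c ∨ w = f)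
    (hb : ∃ d, ∀ w, G.Adj b w → w = q ∨ w = d)
    (hqp : q ≠ p) (hxa : x ≠ a) (hxb : x ≠ b) (hpc : p ≠ c) (hae : a ≠ e) (hcf : c ≠ f) :
    ∃ c, G.IsSevenCycle c ∧ x ∈ Set.range c := by
  classical
  have nqp : ¬ G.Adj q p := fun h => hS.three q x p hqx hxp h.symm
  have npc : ¬ G.Adj p c := fun h => hS.three p a c hpa hac h.symm
  have nxa : ¬ G.Adj x a := fun h => hS.three x p a hxp hpa h.symm
  have nqa : ¬ G.Adj q a := fun h => by
    rcases hS.four q x p a hqx hxp hpa h.symm with h | h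
    exacts [hqp h, hxa h]
  have nxc : ¬ G.Adj x c := fun h => by
    rcases hS.four x p a c hxp hpa hac h.symm with h | h
    exacts [hxa h, hpc h]
  have npe : ¬ G.Adj p e := fun h => by
    rcases hS.four p a c e hpa hac hce h.symm with h | h
    exacts [hpc h, hae h]
  have nqc : ¬ G.Adj q c := fun h => hS.five q x p a c hqx hxp hpa hac h.symm
  have nxe : ¬ G.Adj x e := fun h => hS.five x p a c e hxp hpa hac hce h.symm
  have nae : ¬ G.Adj a e := fun h => hS.three a c e hac hce h.symm
  have ncf : ¬ G.Adj c f := fun h => hS.three c e f hce hef h.symm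
  have naf : ¬ G.Adj a f := fun h => by
    rcases hS.four a c e f hac hce hef h.symm with h | h
    exacts [hae h, hcf h]
  have npf : ¬ G.Adj p f := fun h => hS.five p a c e f hpa hac hce hef h.symm
  have hqc : q ≠ c := fun h => nqa (h ▸ hac.symm)
  have hxc : x ≠ c := fun h => nxa (h ▸ hac.symm)
  have hqa : q ≠ a := fun h => nqp (h ▸ hpa.symm)
  have hpe : p ≠ e := fun h => npc (h ▸ hce.symm)
  have hxe : x ≠ e := fun h => nxc (h ▸ hce.symm)
  have hqe : q ≠ e := fun h => nqc (h ▸ hce.symm)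
  have hpf : p ≠ f := fun h => npe (h ▸ hef.symm)
  have haf : a ≠ f := fun h => nae (h ▸ hef.symm)
  rcases eq_or_ne e b with rfl | heb
  · -- The walk closes up as a six-cycle, where two opposite vertices dominate everything.
    exfalso
    have hcard := hG {p, q, c} {x, c} (by
        rw [isIndepSet_coe_iff]
        simp only [Finset.mem_insert, Finset.mem_singleton]
        rintro u (rfl | rfl | rfl) w (rfl | rfl | rfl) h <;>
          first
          | exact h.ne rfl
          | (have := h.symm; contradiction)) (by
        rw [isIndepSet_coe_iff]
        simp only [Finset.mem_insert, Finset.mem_singleton]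
        rintro u (rfl | rfl) w (rfl | rfl) h <;>
          first
          | exact h.ne rfl
          | (have := h.symm; contradiction)) (by
        rintro y ⟨u, hu, huy⟩
        simp only [Finset.mem_insert, Finset.mem_singleton] at hu
        rcases hu with rfl | rfl | rfl
        · rcases huy with rfl | huy
          · exact ⟨x, by simp, .inr hxp⟩
          · rcases hp y huy with rfl | rfl
            · exact ⟨y, by simp, .inl rfl⟩
            · exact ⟨c, by simp, .inr hac.symm⟩
        · rcases huy with rfl | huy
          · exact ⟨x, by simp, .inr hqx.symm⟩
          · rcases hq y huy with rfl | rfl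
            · exact ⟨y, by simp, .inl rfl⟩
            · exact ⟨c, by simp, .inr hce⟩
        · exact ⟨u, by simp, huy⟩)
    rw [Finset.card_insert_of_notMem (by simp [hqp.symm, hpc]), Finset.card_pair hqc,
      Finset.card_pair hxc] at hcard
    omega
  have hxf : x ≠ f := fun h => nxe (h ▸ hef.symm)
  have hqf : q ≠ f := by
    rintro rfl
    rcases hq e hef.symm with h | h
    exacts [hxe h.symm, heb h]
  rcases eq_or_ne f b with rfl | hfb
  · obtain ⟨d, hd⟩ := hb
    have hde : e = d := (hd e hef.symm).resolve_left hqe.symm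
    subst hde
    have := hac.ne
    have := hce.ne
    refine ⟨![x, p, a, c, e, f, q], ⟨?_, ?_, ?_⟩, 0, rfl⟩
    · have := hbq.ne; have := hqx.ne; have := hxp.ne; have := hpa.ne; have := hef.ne
      intro i j hij
      fin_cases i <;> fin_cases j <;> simp at hij ⊢ <;> grind
    · intro i
      fin_cases i
      exacts [hxp, hpa, hac, hce, hef, hbq, hqx]
    · intro i w hw
      fin_cases i
      exacts [hx w hw, (hp w hw).symm, (ha w hw).symm, (hc w hw).symm, (he w hw).symm, hd w hw,
        hq w hw]
  · -- On longer cycles `{q, a, f}` dominates the larger set `{q, p, c, f}`.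
    exfalso
    have nqf : ¬ G.Adj q f := fun h => by
      rcases hq f h with h | h
      exacts [hxf h.symm, hfb h]
    have hcard := hG {q, p, c, f} {q, a, f} (by
        rw [isIndepSet_coe_iff]
        simp only [Finset.mem_insert, Finset.mem_singleton]
        rintro u (rfl | rfl | rfl | rfl) w (rfl | rfl | rfl | rfl) h <;>
          first
          | exact h.ne rfl
          | (have := h.symm; contradiction)) (by
        rw [isIndepSet_coe_iff]
        simp only [Finset.mem_insert, Finset.mem_singleton]
        rintro u (rfl | rfl | rfl) w (rfl | rfl | rfl) h <;>
          first
          | exact h.ne rfl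
          | (have := h.symm; contradiction)) (by
        rintro y ⟨u, hu, huy⟩
        simp only [Finset.mem_insert, Finset.mem_singleton] at hu
        rcases hu with rfl | rfl | rfl | rfl
        · exact ⟨u, by simp, huy⟩
        · rcases huy with rfl | huy
          · exact ⟨a, by simp, .inr hpa.symm⟩
          · rcases hp y huy with rfl | rfl
            · exact ⟨q, by simp, .inr hqx⟩
            · exact ⟨y, by simp, .inl rfl⟩
        · rcases huy with rfl | huy
          · exact ⟨a, by simp, .inr hac⟩
          · rcases hc y huy with rfl | rfl
            · exact ⟨y, by simp, .inl rfl⟩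
            · exact ⟨f, by simp, .inr hef.symm⟩
        · exact ⟨u, by simp, huy⟩)
    rw [Finset.card_insert_of_notMem (by simp [hqp, hqc, hqf]),
      Finset.card_insert_of_notMem (by simp [hpc, hpf]), Finset.card_pair hcf,
      Finset.card_insert_of_notMem (by simp [hqa, hqf]), Finset.card_pair haf] at hcard
    omega

/-- The structure theorem for well-covered graphs of girth at least six, which need not be
connected: every vertex is isolated, lies on a pendant edge, or lies on a `C₇`-component. -/
theorem DominationMonotone.hasLocalStructure [Finite V] {G : SimpleGraph V}
    (hS : G.NoShortCycle) (hG : G.DominationMonotone) (x : V) : G.HasLocalStructure x := by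
  induction hn : G.edgeSet.ncard using Nat.strong_induction_on generalizing G x with
  | _ n ih =>
  have IH : ∀ {v w : V}, G.Adj v w → ∀ y, (G.detach v).HasLocalStructure y := fun h y =>
    ih _ (hn ▸ detach_ncard_edgeSet_lt h) (hS.mono (detach_le G _)) (hG.detach _) y rfl
  -- Lying on a pendant edge passes to adjacent vertices, and hence so does its negation.
  have hprop : ∀ {a b}, G.Adj a b → G.OnPendantEdge a → G.OnPendantEdge b := by
    rintro a b hab (ha | ⟨l, hal, hl⟩)
    · exact .inr ⟨a, hab.symm, ha⟩
    · exact onPendantEdge_of_adj_adj_isPendant hS hG hl hal.symm hab (IH hal.symm b)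
  have hnot : ∀ {a b}, G.Adj a b → ¬ G.OnPendantEdge a → ¬ G.OnPendantEdge b :=
    fun hab ha hb => ha (hprop hab.symm hb)
  -- A non-isolated vertex off all pendant edges has exactly two neighbours.
  have htwo : ∀ {b p}, ¬ G.OnPendantEdge b → G.Adj b p →
      ∃ w, w ≠ p ∧ G.Adj b w ∧ ∀ q, G.Adj b q → q = p ∨ q = w := by
    intro b p hb hbp
    obtain ⟨v, hpv, hvb⟩ : ∃ v, G.Adj p v ∧ v ≠ b := by
      by_contra! hcon
      exact hnot hbp hb (.inl ⟨b, hbp.symm, hcon⟩)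
    have hbv : ¬ G.Adj v b := fun h => hS.three v b p h hbp hpv
    obtain ⟨w, hw, hu⟩ := isPendant_detach_of_not_onPendantEdge hS hG hpv.symm hbp.symm hvb.symm
      (by rintro y (rfl | hy) hpy
          · exact hb (.inl hpy)
          · exact hb (.inr ⟨y, hy, hpy⟩)) (IH hpv.symm b)
    refine ⟨w, fun h => hw.2.2 (h ▸ hpv.symm), hw.1, fun q hq => ?_⟩
    by_cases hvq : G.Adj v q
    · rcases hS.four v q b p hvq hq.symm hbp hpv with h | h
      · exact (hvb h).elim
      · exact .inl h
    · exact .inr (hu q ⟨hq, hbv, hvq⟩)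
  by_cases hiso : ∀ w, ¬ G.Adj x w
  · exact .inl hiso
  by_cases hpe : G.OnPendantEdge x
  · exact .inr (.inl hpe)
  push Not at hiso
  obtain ⟨p, hxp⟩ := hiso
  obtain ⟨q, hqp, hxq, hx⟩ := htwo hpe hxp
  have hpp := hnot hxp hpe
  have hqq := hnot hxq hpe
  obtain ⟨a, hax, hpa, hp⟩ := htwo hpp hxp.symm
  obtain ⟨b, hbx, hqb, hq⟩ := htwo hqq hxq.symm
  obtain ⟨d, -, -, hb⟩ := htwo (hnot hqb hqq) hqb.symm
  have haa := hnot hpa hpp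
  obtain ⟨c, hcp, hac, ha⟩ := htwo haa hpa.symm
  have hcc := hnot hac haa
  obtain ⟨e, hea, hce, hc⟩ := htwo hcc hac.symm
  obtain ⟨f, hfc, hef, he⟩ := htwo (hnot hce hcc) hce.symm
  exact .inr (.inr (exists_isSevenCycle_of_two_regular_walk hS hG hqb.symm hxq.symm hxp hpa hac hce
    hef hq hx hp ha hc he ⟨d, hb⟩ hqp hax.symm hbx.symm hcp.symm hea.symm hfc.symm))

/-! ### Small connected graphs -/

lemma Connected.mem_of_forall_adj_mem {G : SimpleGraph V} (hG : G.Connected) {S : Set V} {a : V}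
    (ha : a ∈ S) (hS : ∀ x ∈ S, ∀ y, G.Adj x y → y ∈ S) (v : V) : v ∈ S := by
  obtain ⟨w⟩ := hG.preconnected a v
  induction w with
  | nil => exact ha
  | cons h _ ih => exact ih (hS _ ha _ h)

lemma Connected.exists_adj {G : SimpleGraph V} (hG : G.Connected)
    (hK1 : IsEmpty (G ≃g completeGraph (Fin 1))) (v : V) : ∃ w, G.Adj v w := by
  by_contra! hiso
  have hv : ∀ w, w = v := hG.mem_of_forall_adj_mem (S := {v}) rfl (by
    rintro x rfl y hxy
    exact (hiso y hxy).elim)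
  have : Unique V := ⟨⟨v⟩, hv⟩
  exact hK1.false ⟨Equiv.ofUnique V (Fin 1), by
    intro a b
    simp [Subsingleton.elim a b]⟩

lemma Connected.not_isPendant_of_adj {G : SimpleGraph V} (hG : G.Connected)
    (hK2 : IsEmpty (G ≃g completeGraph (Fin 2))) {a b : V} (hab : G.Adj a b)
    (ha : G.IsPendant a) : ¬ G.IsPendant b := by
  intro hb
  have hV : ∀ v, v = a ∨ v = b := hG.mem_of_forall_adj_mem (S := {a, b}) (.inl rfl) (by
    rintro x (rfl | rfl) y hxy
    · exact .inr (ha.unique hxy hab)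
    · exact .inl (hb.unique hxy hab.symm))
  have hbij : Function.Bijective ![a, b] := by
    refine ⟨?_, fun v => ?_⟩
    · intro i j hij
      have := hab.ne
      fin_cases i <;> fin_cases j <;> simp at hij ⊢ <;> grind
    · rcases hV v with rfl | rfl
      exacts [⟨0, rfl⟩, ⟨1, rfl⟩]
  refine hK2.false (RelIso.symm ⟨Equiv.ofBijective _ hbij, ?_⟩)
  intro i j
  have := hab.symm
  fin_cases i <;> fin_cases j <;> simp [hab, this]

lemma IsSevenCycle.nonempty_iso {G : SimpleGraph V} (hG : G.Connected) {c : Fin 7 → V}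
    (hc : G.IsSevenCycle c) : Nonempty (G ≃g cycleGraph 7) := by
  have hsurj : Function.Surjective c := hG.mem_of_forall_adj_mem (S := Set.range c) ⟨0, rfl⟩ (by
    rintro _ ⟨i, rfl⟩ y hy
    rcases hc.eq_or_eq i y hy with rfl | rfl
    exacts [⟨_, rfl⟩, ⟨_, rfl⟩])
  have hbij : Function.Bijective c := ⟨hc.injective, hsurj⟩
  refine ⟨RelIso.symm ⟨Equiv.ofBijective c hbij, ?_⟩⟩
  intro i j
  rw [cycleGraph_adj]
  simp only [Equiv.ofBijective_apply]
  constructor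
  · intro h
    rcases hc.eq_or_eq i _ h with h | h
    · right; rw [hc.injective h]; simp
    · left; rw [hc.injective h]; simp
  · rintro (h | h)
    · have := hc.adj j
      rw [← h, add_sub_cancel] at this
      exact this.symm
    · have := hc.adj i
      rwa [← h, add_sub_cancel] at this

/-! ### From well-coveredness to pendant edges -/

/-- If every vertex lies on a pendant edge, then these edges form a perfect matching as soon as no
two pendant vertices share their neighbour. -/
lemma hasPerfectMatchingOfPendantEdges_of_onPendantEdge {G : SimpleGraph V}
    (h : ∀ x, G.OnPendantEdge x)
    (hu : ∀ v l l', G.IsPendant l → G.IsPendant l' → G.Adj v l → G.Adj v l' → l = l') :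
    G.HasPerfectMatchingOfPendantEdges := by
  let M : G.Subgraph :=
    { verts := Set.univ
      Adj := fun a b => G.Adj a b ∧ (G.IsPendant a ∨ G.IsPendant b)
      adj_sub := fun h => h.1
      edge_vert := fun _ => trivial
      symm := ⟨fun _ _ h => ⟨h.1.symm, h.2.symm⟩⟩ }
  refine ⟨M, Subgraph.isPerfectMatching_iff.2 fun v => ?_, fun e he => ?_⟩
  · by_cases hv : G.IsPendant v
    · obtain ⟨w, hw, huw⟩ := hv
      exact ⟨w, ⟨hw, .inl ⟨w, hw, huw⟩⟩, fun y hy => huw y hy.1⟩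
    · obtain ⟨l, hvl, hl⟩ := (h v).resolve_left hv
      exact ⟨l, ⟨hvl, .inr hl⟩, fun y hy => hu v y l (hy.2.resolve_left hv) hl hy.1 hvl⟩
  · induction e with
    | _ a b =>
      have hab : G.Adj a b ∧ (G.IsPendant a ∨ G.IsPendant b) := he
      refine ⟨hab.1, ?_⟩
      rcases hab.2 with h | h
      · exact ⟨a, by simp, h⟩
      · exact ⟨b, by simp, h⟩

lemma IsWellCovered.hasPerfectMatchingOfPendantEdges [Fintype V] {G : SimpleGraph V}
    (hG : G.IsWellCovered) (hconn : G.Connected) (hgirth : 6 ≤ G.egirth)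
    (hC7 : IsEmpty (G ≃g cycleGraph 7)) (hK1 : IsEmpty (G ≃g completeGraph (Fin 1))) :
    G.HasPerfectMatchingOfPendantEdges := by
  have hS := noShortCycle_of_six_le_egirth hgirth
  have hD := hG.dominationMonotone
  refine hasPerfectMatchingOfPendantEdges_of_onPendantEdge (fun x => ?_)
    fun v l l' hl hl' => hD.eq_of_isPendant hl hl'
  rcases hD.hasLocalStructure hS x with hx | hx | ⟨c, hc, -⟩
  · obtain ⟨w, hw⟩ := hconn.exists_adj hK1 x
    exact (hx w hw).elim
  · exact hx
  · exact (not_isEmpty_iff.2 (hc.nonempty_iso hconn) hC7).elim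

/-! ### Consequences of a perfect matching of pendant edges -/

/-- A perfect matching of pendant edges, encoded by the map sending each vertex to its partner. -/
structure IsPendantPairing (G : SimpleGraph V) (σ : V → V) : Prop where
  adj : ∀ v, G.Adj v (σ v)
  involutive : Function.Involutive σ
  isPendant : ∀ v, G.IsPendant v ∨ G.IsPendant (σ v)

lemma HasPerfectMatchingOfPendantEdges.exists_isPendantPairing {G : SimpleGraph V}
    (h : G.HasPerfectMatchingOfPendantEdges) :
    ∃ σ, G.IsPendantPairing σ := by
  obtain ⟨M, hM, hp⟩ := h
  rw [Subgraph.isPerfectMatching_iff] at hM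
  choose σ hσ hu using hM
  refine ⟨σ, fun v => (hσ v).adj_sub, fun v => (hu (σ v) v (hσ v).symm).symm, fun v => ?_⟩
  obtain ⟨-, u, hu, hup⟩ := hp s(v, σ v) (hσ v)
  rcases Sym2.mem_iff.1 hu with rfl | rfl
  exacts [.inl hup, .inr hup]

lemma IsPendantPairing.eq_of_adj {G : SimpleGraph V} {σ : V → V} (h : G.IsPendantPairing σ)
    {v w : V} (hv : G.IsPendant v) (hvw : G.Adj v w) : w = σ v :=
  hv.unique hvw (h.adj v)

/-- A set containing exactly one vertex of each pair makes up half of the vertices. -/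
lemma IsPendantPairing.card_eq [Fintype V] {G : SimpleGraph V} {σ : V → V}
    (h : G.IsPendantPairing σ) {T : Finset V} (hT : ∀ v, v ∈ T ↔ σ v ∉ T) :
    Fintype.card V = 2 * T.card := by
  classical
  have : T.card = Tᶜ.card := by
    refine Finset.card_bij (fun v _ => σ v) (fun v hv => ?_) (fun a _ b _ hab => ?_) fun v hv => ?_
    · rw [Finset.mem_compl]
      exact (hT v).1 hv
    · exact h.involutive.injective hab
    · refine ⟨σ v, ?_, h.involutive v⟩
      rw [hT, h.involutive v]
      exact Finset.mem_compl.1 hv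
  have := Finset.card_add_card_compl T
  omega

lemma IsPendantPairing.card_of_maximal [Fintype V] {G : SimpleGraph V} {σ : V → V}
    (h : G.IsPendantPairing σ) {T : Finset V} (hT : Maximal G.IsIndepSet (T : Set V)) :
    Fintype.card V = 2 * T.card := by
  have hind := isIndepSet_coe_iff.1 hT.prop
  refine h.card_eq fun v => ⟨fun hv hσ => hind v hv _ hσ (h.adj v), fun hσ => ?_⟩
  by_contra hv
  rcases h.isPendant v with hp | hp
  · obtain ⟨w, hw, hvw⟩ := exists_adj_of_maximal_isIndepSet hT hv
    exact hσ (h.eq_of_adj hp hvw ▸ hw)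
  · obtain ⟨w, hw, hvw⟩ := exists_adj_of_maximal_isIndepSet hT hσ
    have := h.eq_of_adj hp hvw
    rw [h.involutive v] at this
    exact hv (this ▸ hw)

lemma IsPendantPairing.isWellCovered [Fintype V] {G : SimpleGraph V} {σ : V → V}
    (h : G.IsPendantPairing σ) : G.IsWellCovered := by
  refine fun S hS => ⟨hS.prop, fun t ht => ?_⟩
  obtain ⟨T, htT, hT⟩ := exists_maximal_isIndepSet ht
  have := Finset.card_le_card htT
  have := h.card_of_maximal hS
  have := h.card_of_maximal hT
  omega

lemma IsPendantPairing.card_eq_two_mul_indepNum [Fintype V] {G : SimpleGraph V} {σ : V → V}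
    (h : G.IsPendantPairing σ) : Fintype.card V = 2 * G.indepNum := by
  obtain ⟨S, hS⟩ := G.maximumIndepSet_exists
  rw [← maximumIndepSet_card_eq_indepNum S hS]
  exact h.card_of_maximal (hS.isMaximalIndepSet S)

lemma IsPendantPairing.isVeryWellCovered [Fintype V] {G : SimpleGraph V} {σ : V → V}
    (h : G.IsPendantPairing σ) : G.IsVeryWellCovered :=
  ⟨h.isWellCovered, fun v => ⟨σ v, h.adj v⟩, h.card_eq_two_mul_indepNum⟩

lemma IsWellCovered.core_eq_empty [Fintype V] {G : SimpleGraph V} (hG : G.IsWellCovered)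
    (hiso : ∀ v, ∃ w, G.Adj v w) : G.core = ∅ := by
  rw [Set.eq_empty_iff_forall_notMem]
  intro v hv
  obtain ⟨w, hvw⟩ := hiso v
  -- A maximal stable set through a neighbour of `v` is a maximum stable set that avoids `v`.
  obtain ⟨T, hwT, hT⟩ := exists_maximal_isIndepSet (G := G) (B := {w}) (by simp)
  exact isIndepSet_coe_iff.1 hT.prop v (hv T (hG T hT)) w (hwT (by simp)) hvw

/-! ### Matchings and stable sets -/

/-- Each edge of `M` has an endpoint outside the stable set `S`. In a matching these endpoints can
be chosen injectively. -/
lemma Subgraph.IsMatching.exists_injective_endpoint {G : SimpleGraph V} {M : G.Subgraph}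
    (hM : M.IsMatching) {S : Finset V} (hS : G.IsIndepSet (S : Set V)) :
    ∃ f : M.edgeSet → {v // v ∉ S}, Function.Injective f ∧
      (∀ e : M.edgeSet, (f e : V) ∈ (e : Sym2 V)) ∧
      ∀ e e' : M.edgeSet, ∀ v ∈ (e : Sym2 V), v ∈ (e' : Sym2 V) → e = e' := by
  have hinc : ∀ e e' : M.edgeSet, ∀ v ∈ (e : Sym2 V), v ∈ (e' : Sym2 V) → e = e' := by
    rintro ⟨e, he⟩ ⟨e', he'⟩ v hv hv'
    obtain ⟨a, rfl⟩ := Sym2.mem_iff_exists.1 hv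
    obtain ⟨b, rfl⟩ := Sym2.mem_iff_exists.1 hv'
    have hab : a = b := hM.eq_of_adj_left he he'
    subst hab
    rfl
  have hex : ∀ e : M.edgeSet, ∃ v : {v // v ∉ S}, (v : V) ∈ (e : Sym2 V) := by
    rintro ⟨e, he⟩
    induction e with
    | _ a b =>
      by_cases ha : a ∈ S
      · have hb : b ∉ S := fun hb => isIndepSet_coe_iff.1 hS a ha b hb (M.adj_sub he)
        exact ⟨⟨b, hb⟩, by simp⟩
      · exact ⟨⟨a, ha⟩, by simp⟩
  choose f hf using hex
  exact ⟨f, fun e e' h => hinc e e' (f e) (hf e) (h ▸ hf e'), hf, hinc⟩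

lemma Subgraph.IsMatching.ncard_edgeSet_add_card_le [Fintype V] {G : SimpleGraph V}
    {M : G.Subgraph} (hM : M.IsMatching) {S : Finset V} (hS : G.IsIndepSet (S : Set V)) :
    M.edgeSet.ncard + S.card ≤ Fintype.card V := by
  classical
  obtain ⟨f, hf, -, -⟩ := hM.exists_injective_endpoint hS
  have h := Nat.card_le_card_of_injective f hf
  rw [Nat.card_coe_set_eq, Nat.card_eq_fintype_card, Fintype.card_subtype_compl,
    Fintype.card_coe] at h
  have := Finset.card_le_univ S
  omega

lemma bddAbove_matching_ncard [Fintype V] (G : SimpleGraph V) :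
    BddAbove {k | ∃ M : G.Subgraph, M.IsMatching ∧ M.edgeSet.ncard = k} := by
  refine ⟨Fintype.card V, ?_⟩
  rintro _ ⟨M, hM, rfl⟩
  have := hM.ncard_edgeSet_add_card_le (S := ∅) (by simp)
  simpa using this

lemma exists_isMatching_ncard_eq_matchingNumber [Fintype V] (G : SimpleGraph V) :
    ∃ M : G.Subgraph, M.IsMatching ∧ M.edgeSet.ncard = G.matchingNumber :=
  Nat.sSup_mem (s := {k | ∃ M : G.Subgraph, M.IsMatching ∧ M.edgeSet.ncard = k})
    ⟨0, ⊥, by intro v hv; exact hv.elim, by simp⟩ G.bddAbove_matching_ncard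

/-- In a König–Egerváry graph some matching joins all vertices outside a given maximum stable set
to vertices inside. -/
lemma IsKonigEgervary.exists_isMatching [Fintype V] {G : SimpleGraph V} (hG : G.IsKonigEgervary)
    {S : Finset V} (hS : G.IsIndepSet (S : Set V)) (hcard : S.card = G.indepNum) :
    ∃ M : G.Subgraph, M.IsMatching ∧ ∀ v ∉ S, ∃ w ∈ S, M.Adj v w := by
  classical
  obtain ⟨M, hM, hMc⟩ := G.exists_isMatching_ncard_eq_matchingNumber
  refine ⟨M, hM, fun v hv => ?_⟩
  obtain ⟨f, hf, hmem, hinc⟩ := hM.exists_injective_endpoint hS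
  -- There are as many edges as vertices outside `S`, so every such vertex is a chosen endpoint.
  have hbij : Function.Bijective f := by
    rw [Nat.bijective_iff_injective_and_card]
    refine ⟨hf, ?_⟩
    rw [Nat.card_coe_set_eq, Nat.card_eq_fintype_card, Fintype.card_subtype_compl,
      Fintype.card_coe, hMc]
    have : G.indepNum + G.matchingNumber = Fintype.card V := hG
    omega
  obtain ⟨e, he⟩ := hbij.2 ⟨v, hv⟩
  have hve : v ∈ (e : Sym2 V) := by simpa [he] using hmem e
  obtain ⟨w, hw⟩ := Sym2.mem_iff_exists.1 hve
  have hvw : M.Adj v w := by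
    have := e.2
    rwa [hw] at this
  refine ⟨w, ?_, hvw⟩
  by_contra hwS
  obtain ⟨e', he'⟩ := hbij.2 ⟨w, hwS⟩
  have hee : e = e' := hinc e e' w (by simp [hw]) (by simpa [he'] using hmem e')
  rw [← hee, he] at he'
  exact hvw.ne (congrArg Subtype.val he')

/-- A matching of the complement of `S` into `S` that covers `S` consists of pendant edges if `S`
consists of pendant vertices. -/
lemma hasPerfectMatchingOfPendantEdges_of_isMatching {G : SimpleGraph V} {M : G.Subgraph}
    (hM : M.IsMatching) {S : Finset V} (hS : ∀ s ∈ S, G.IsPendant s)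
    (hout : ∀ v ∉ S, ∃ w ∈ S, M.Adj v w) (hin : ∀ s ∈ S, ∃ w, M.Adj s w) :
    G.HasPerfectMatchingOfPendantEdges := by
  refine ⟨M, ⟨hM, fun v => ?_⟩, fun e he => ?_⟩
  · by_cases hv : v ∈ S
    · obtain ⟨w, hw⟩ := hin v hv
      exact hw.fst_mem
    · obtain ⟨w, -, hw⟩ := hout v hv
      exact hw.fst_mem
  · induction e with
    | _ a b =>
      have hab : M.Adj a b := he
      refine ⟨hab.adj_sub, ?_⟩
      by_cases ha : a ∈ S
      · exact ⟨a, by simp, hS a ha⟩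
      · obtain ⟨w, hw, haw⟩ := hout a ha
        obtain rfl := hM.eq_of_adj_left hab haw
        exact ⟨b, by simp, hS b hw⟩

/-! ### König–Egerváry graphs with pendant edges -/

lemma HasPerfectMatchingOfPendantEdges.isKonigEgervary [Fintype V] {G : SimpleGraph V}
    (h : G.HasPerfectMatchingOfPendantEdges) : G.IsKonigEgervary := by
  classical
  obtain ⟨σ, hσ⟩ := h.exists_isPendantPairing
  have hcard := hσ.card_eq_two_mul_indepNum
  obtain ⟨S, hS⟩ := G.maximumIndepSet_exists
  have hSα := maximumIndepSet_card_eq_indepNum S hS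
  obtain ⟨M, hM, hMc⟩ := G.exists_isMatching_ncard_eq_matchingNumber
  have hle := hM.ncard_edgeSet_add_card_le hS.isIndepSet
  -- Distinct vertices of the stable set `S` lie on distinct edges of the perfect matching.
  obtain ⟨P, hP, -⟩ := h
  have hPmax : P.edgeSet.ncard ≤ G.matchingNumber :=
    le_csSup G.bddAbove_matching_ncard ⟨P, hP.1, rfl⟩
  rw [Subgraph.isPerfectMatching_iff] at hP
  choose τ hτ hτu using hP
  have hSP : S.card ≤ P.edgeSet.ncard := by
    rw [← Set.ncard_coe_finset]
    refine Set.ncard_le_ncard_of_injOn (fun v => s(v, τ v)) (fun v _ => hτ v) ?_ (Set.toFinite _)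
    intro a ha b hb hab
    rcases Sym2.eq_iff.1 hab with h | h
    · exact h.1
    · exact (isIndepSet_coe_iff.1 hS.isIndepSet b hb a ha (h.1 ▸ (hτ b).adj_sub)).elim
  change G.indepNum + G.matchingNumber = Fintype.card V
  omega

/-- Vertices at distance two have a common neighbour. -/
lemma exists_adj_adj_of_dist_eq_two {G : SimpleGraph V} {u v : V} (h : G.dist u v = 2) :
    ∃ w, G.Adj u w ∧ G.Adj v w := by
  have hr : G.Reachable u v := by
    by_contra hr
    rw [dist_eq_zero_of_not_reachable hr] at h
    omega
  obtain ⟨w, hw⟩ := hr.exists_walk_length_eq_dist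
  rw [h] at hw
  refine ⟨w.getVert 1, ?_, ?_⟩
  · simpa using w.adj_getVert_succ (i := 0) (by omega)
  · have := (w.adj_getVert_succ (i := 1) (by omega)).symm
    rwa [show 1 + 1 = w.length by omega, w.getVert_length] at this

lemma secondPower_adj_of_adj_adj {G : SimpleGraph V} {u v w : V} (huv : u ≠ v)
    (hu : G.Adj u w) (hv : G.Adj v w) : G.secondPower.Adj u v := by
  by_cases h : G.Adj u v
  · exact .inl h
  right
  let p : G.Walk u v := .cons hu (.cons hv.symm .nil)
  have hle : G.dist u v ≤ 2 := dist_le p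
  have h0 : G.dist u v ≠ 0 := fun h0 => huv ((Reachable.dist_eq_zero_iff ⟨p⟩).1 h0)
  have h1 : G.dist u v ≠ 1 := fun h1 => h (dist_eq_one_iff_adj.1 h1)
  omega

lemma IsPendantPairing.isSquareStable [Fintype V] {G : SimpleGraph V} {σ : V → V}
    (h : G.IsPendantPairing σ) : G.IsSquareStable := by
  classical
  refine le_antisymm ?_ ?_
  · -- Picking a pendant vertex from the pair of each vertex of a maximum stable set `S` gives a
    -- set which is stable in the square.
    obtain ⟨S, hS⟩ := G.maximumIndepSet_exists
    have hSi := isIndepSet_coe_iff.1 hS.isIndepSet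
    have hg : ∀ v, ∃ w, (w = v ∨ w = σ v) ∧ G.IsPendant w := fun v => by
      rcases h.isPendant v with hv | hv
      exacts [⟨v, .inl rfl, hv⟩, ⟨σ v, .inr rfl, hv⟩]
    choose g hg hgp using hg
    have hpair : ∀ a ∈ S, ∀ b ∈ S, g a = g b ∨ g a = σ (g b) → a = b := by
      intro a ha b hb hab
      have hσ := h.involutive
      have : a = b ∨ a = σ b := by
        have := hg a
        have := hg b
        have := hσ a
        have := hσ b
        grind
      rcases this with rfl | rfl
      · rfl
      · exact (hSi b hb _ ha (h.adj b)).elim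
    rw [← maximumIndepSet_card_eq_indepNum S hS]
    have himg : (S.image g).card = S.card :=
      Finset.card_image_of_injOn fun a ha b hb hab => hpair a ha b hb (.inl hab)
    rw [← himg]
    refine IsIndepSet.card_le_indepNum ?_
    rw [isIndepSet_coe_iff]
    simp only [Finset.mem_image]
    rintro _ ⟨a, ha, rfl⟩ _ ⟨b, hb, rfl⟩ (hab | hab)
    · have heq : a = b := hpair a ha b hb (.inr (h.eq_of_adj (hgp b) hab.symm))
      exact hab.ne (congrArg g heq)
    · obtain ⟨w, haw, hbw⟩ := exists_adj_adj_of_dist_eq_two hab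
      have hgg : g a = g b := h.involutive.injective
        ((h.eq_of_adj (hgp a) haw).symm.trans (h.eq_of_adj (hgp b) hbw))
      rw [hgg, dist_self] at hab
      omega
  · obtain ⟨S, hS⟩ := G.secondPower.maximumIndepSet_exists
    rw [← maximumIndepSet_card_eq_indepNum S hS]
    refine IsIndepSet.card_le_indepNum ?_
    rw [isIndepSet_coe_iff]
    exact fun a ha b hb hab => isIndepSet_coe_iff.1 hS.isIndepSet a ha b hb (.inl hab)

lemma IsPendantPairing.ncard_isPendant [Fintype V] {G : SimpleGraph V} {σ : V → V}
    (h : G.IsPendantPairing σ)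
    (hpend : ∀ a b, G.Adj a b → G.IsPendant a → ¬ G.IsPendant b) :
    {v : V | G.IsPendant v}.ncard = G.indepNum := by
  classical
  have h1 := h.card_eq (T := Finset.univ.filter G.IsPendant) fun v => by
    simp only [Finset.mem_filter, Finset.mem_univ, true_and]
    exact ⟨hpend _ _ (h.adj v), (h.isPendant v).resolve_right⟩
  have h2 := h.card_eq_two_mul_indepNum
  rw [← Set.ncard_coe_finset] at h1
  simp only [Finset.coe_filter, Finset.mem_univ, true_and] at h1
  omega

lemma IsKonigEgervary.hasPerfectMatchingOfPendantEdges_of_isSquareStable [Fintype V]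
    {G : SimpleGraph V} (hG : G.IsKonigEgervary) (hsq : G.IsSquareStable)
    (hiso : ∀ v, ∃ w, G.Adj v w) : G.HasPerfectMatchingOfPendantEdges := by
  obtain ⟨S, hS⟩ := G.secondPower.maximumIndepSet_exists
  have hcard : S.card = G.indepNum := (maximumIndepSet_card_eq_indepNum S hS).trans hsq.symm
  have hS2 := isIndepSet_coe_iff.1 hS.isIndepSet
  have hind : ∀ a ∈ S, ∀ b ∈ S, ¬ G.Adj a b := fun a ha b hb hab => hS2 a ha b hb (.inl hab)
  obtain ⟨M, hM, hout⟩ := hG.exists_isMatching (isIndepSet_coe_iff.2 hind) hcard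
  -- A neighbour of `s ∈ S` is matched into `S`, hence to `s`, the only element of `S` in reach.
  have hadj : ∀ s ∈ S, ∀ a, G.Adj s a → M.Adj s a := by
    intro s hs a hsa
    obtain ⟨w, hw, haw⟩ := hout a fun ha => hind s hs a ha hsa
    have hsw : s = w := by
      by_contra hne
      exact hS2 s hs w hw (secondPower_adj_of_adj_adj hne hsa haw.adj_sub.symm)
    exact hsw ▸ haw.symm
  refine hasPerfectMatchingOfPendantEdges_of_isMatching hM (fun s hs => ?_) hout fun s hs => ?_
  · obtain ⟨a, ha⟩ := hiso s
    exact ⟨a, ha, fun b hb => hM.eq_of_adj_left (hadj s hs b hb) (hadj s hs a ha)⟩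
  · obtain ⟨a, ha⟩ := hiso s
    exact ⟨a, hadj s hs a ha⟩

lemma IsKonigEgervary.hasPerfectMatchingOfPendantEdges_of_core_eq_empty [Fintype V]
    {G : SimpleGraph V} (hG : G.IsKonigEgervary)
    (hcard : {v : V | G.IsPendant v}.ncard = G.indepNum) (hcore : G.core = ∅)
    (hpend : ∀ a b, G.Adj a b → G.IsPendant a → ¬ G.IsPendant b) :
    G.HasPerfectMatchingOfPendantEdges := by
  classical
  let S : Finset V := Finset.univ.filter G.IsPendant
  have hmem : ∀ v, v ∈ S ↔ G.IsPendant v := by simp [S]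
  have hScard : S.card = G.indepNum := by
    rw [← hcard, ← Set.ncard_coe_finset]
    simp [S]
  have hind : G.IsIndepSet (S : Set V) := isIndepSet_coe_iff.2 fun a ha b hb hab =>
    hpend a b hab ((hmem a).1 ha) ((hmem b).1 hb)
  obtain ⟨M, hM, hout⟩ := hG.exists_isMatching hind hScard
  refine hasPerfectMatchingOfPendantEdges_of_isMatching hM (fun s hs => (hmem s).1 hs) hout
    fun s hs => ?_
  have hsp := (hmem s).1 hs
  obtain ⟨a, hsa, hsu⟩ := (hmem s).1 hs
  have haS : a ∉ S := fun ha => hpend s a hsa hsp ((hmem a).1 ha)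
  obtain ⟨s', hs', has'⟩ := hout a haS
  rcases eq_or_ne s s' with rfl | hne
  · exact ⟨a, has'.symm⟩
  -- Otherwise the pendant vertices `s` and `s'` share their neighbour `a`, and every maximum stable
  -- set contains `s`: one avoiding `s` could be enlarged, if need be trading `a` for `s` and `s'`.
  exfalso
  have hs'u : ∀ b, G.Adj s' b → b = a := fun b hb =>
    ((hmem s').1 hs').unique hb has'.adj_sub.symm
  have hs : s ∈ G.core := by
    intro T hT
    by_contra hsT
    have hTi := isIndepSet_coe_iff.1 hT.isIndepSet
    have hnew : G.IsIndepSet ((insert s (insert s' (T.erase a)) : Finset V) : Set V) := by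
      rw [isIndepSet_coe_iff]
      have hnot : ∀ y ∈ insert s (insert s' (T.erase a)), y ≠ a := by
        have := has'.ne
        have := hsa.ne
        grind
      intro x hx y hy hxy
      have hxa := hnot x hx
      have hya := hnot y hy
      simp only [Finset.mem_insert, Finset.mem_erase] at hx hy
      rcases hx with rfl | rfl | hx
      · exact hya (hsu y hxy)
      · exact hya (hs'u y hxy)
      rcases hy with rfl | rfl | hy
      · exact hxa (hsu x hxy.symm)
      · exact hxa (hs'u x hxy.symm)
      exact hTi x hx.2 y hy.2 hxy
    have hle := hT.maximum _ hnew
    have hsn : s ∉ insert s' (T.erase a) := by simp [hne, hsT]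
    rw [Finset.card_insert_of_notMem hsn] at hle
    by_cases haT : a ∈ T
    · have hs'n : s' ∉ T.erase a := fun h =>
        hTi a haT s' (Finset.mem_of_mem_erase h) has'.adj_sub
      rw [Finset.card_insert_of_notMem hs'n, Finset.card_erase_of_mem haT] at hle
      omega
    · rw [Finset.erase_eq_of_notMem haT] at hle
      have := Finset.card_le_card (Finset.subset_insert s' T)
      omega
  simp [hcore] at hs

end SimpleGraph

theorem mainTheorem3 {V : Type*} [Fintype V] (G : SimpleGraph V) (hconn : G.Connected)
    (hgirth : 6 ≤ G.egirth)
    (hC7 : IsEmpty (G ≃g SimpleGraph.cycleGraph 7))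
    (hK1 : IsEmpty (G ≃g SimpleGraph.completeGraph (Fin 1))) :
    List.TFAE
      [G.IsWellCovered,
       G.HasPerfectMatchingOfPendantEdges,
       G.IsVeryWellCovered,
       G.IsKonigEgervary ∧ G.IsSquareStable] ∧
    (IsEmpty (G ≃g SimpleGraph.completeGraph (Fin 2)) →
      List.TFAE
        [G.IsWellCovered,
         G.HasPerfectMatchingOfPendantEdges,
         G.IsVeryWellCovered,
         G.IsKonigEgervary ∧ {v : V | G.IsPendant v}.ncard = G.indepNum ∧ G.core = ∅,
         G.IsKonigEgervary ∧ G.IsSquareStable]) := by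
  have hiso := hconn.exists_adj hK1
  have h12 : G.IsWellCovered → G.HasPerfectMatchingOfPendantEdges := fun h =>
    h.hasPerfectMatchingOfPendantEdges hconn hgirth hC7 hK1
  have h23 : G.HasPerfectMatchingOfPendantEdges → G.IsVeryWellCovered := fun h =>
    h.exists_isPendantPairing.choose_spec.isVeryWellCovered
  have h31 : G.IsVeryWellCovered → G.IsWellCovered := fun h => h.1
  have h25 : G.HasPerfectMatchingOfPendantEdges → G.IsKonigEgervary ∧ G.IsSquareStable := fun h =>
    ⟨h.isKonigEgervary, h.exists_isPendantPairing.choose_spec.isSquareStable⟩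
  have h52 : G.IsKonigEgervary ∧ G.IsSquareStable → G.HasPerfectMatchingOfPendantEdges := fun h =>
    h.1.hasPerfectMatchingOfPendantEdges_of_isSquareStable h.2 hiso
  refine ⟨?_, fun hK2 => ?_⟩
  · tfae_have 1 → 2 := h12
    tfae_have 2 → 3 := h23
    tfae_have 3 → 1 := h31
    tfae_have 2 → 4 := h25
    tfae_have 4 → 2 := h52
    tfae_finish
  · have hpend : ∀ a b, G.Adj a b → G.IsPendant a → ¬ G.IsPendant b := fun _ _ =>
      hconn.not_isPendant_of_adj hK2
    tfae_have 1 → 2 := h12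
    tfae_have 2 → 3 := h23
    tfae_have 3 → 1 := h31
    tfae_have 2 → 5 := h25
    tfae_have 5 → 2 := h52
    tfae_have 2 → 4 := fun h =>
      ⟨h.isKonigEgervary, h.exists_isPendantPairing.choose_spec.ncard_isPendant hpend,
        (h31 (h23 h)).core_eq_empty hiso⟩
    tfae_have 4 → 2 := fun h =>
      h.1.hasPerfectMatchingOfPendantEdges_of_core_eq_empty h.2.1 h.2.2 hpend
    tfae_finish
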